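/- Let $b\ge 2$ be an integer and $\omega_b=\exp(2\pi\sqrt{-1}/b)$. Write the $b$-adic expansion of a nonnegative integer $k$ as $k=\kappa_1b^{a_1-1}+\cdots+\kappa_vb^{a_v-1}$ with integers $0<\kappa_i\le b-1$ and $a_1>\cdots>a_v\ge 1$ (so $v=0$ for $k=0$), and put $v(k)=v$. For $n\ge 0$ let $k_{\le n}=\sum_{i=1}^{\min(n,v)}\kappa_ib^{a_i-1}$ and $k_{>n}=\sum_{i=n+1}^{v}\kappa_ib^{a_i-1}$. For $x\in[0,1)$ with $b$-adic expansion $x=\xi_1b^{-1}+\xi_2b^{-2}+\cdots$ in which infinitely many digits $\xi_i$ differ from $b-1$, let $\mathrm{wal}_k(x)=\omega_b^{\sum_{i=1}^v\kappa_i\xi_{a_i}}$. Define $W(k)\colon[0,1]\to\mathbb C$ recursively by $W(0)(x)=1$ and, for $k>0$, $$W(k)(x)=\int_0^x\overline{\mathrm{wal}_{\kappa_vb^{a_v-1}}(y)}\,W(k')(y)\,dy,\qquad k'=k-\kappa_vb^{a_v-1}.$$ For $\boldsymbol k=(k_1,\dots,k_s)$ a vector of nonnegative integers, let $\widehat f(\boldsymbol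 k)=\int_{[0,1)^s}f(\boldsymbol x)\,\overline{\prod_{j=1}^s\mathrm{wal}_{k_j}(x_j)}\,d\boldsymbol x$, and write $f^{(m_1,\dots,m_s)}=(\partial/\partial x_1)^{m_1}\cdots(\partial/\partial x_s)^{m_s}f$ (with one-sided derivatives at the boundary of the cube). **Theorem.** Let $\boldsymbol k=(k_1,\dots,k_s)$ and $(\alpha_1,\dots,\alpha_s)$ be vectors of nonnegative integers, and let $f\colon[0,1]^s\to\mathbb R$ have continuous mixed partial derivatives up to order $\alpha_j$ in each variable $x_j$, i.e. $f^{(m_1,\dots,m_s)}$ exists and is continuous on $[0,1]^s$ whenever $0\le m_j\le\alpha_j$ for all $j$. Let $n_j$ be integers with $0\le n_j\le\min(\alpha_j,v(k_j))$ for $1\le j\le s$. Then $$\widehat f(\boldsymbol k)=(-1)^{n_1+\cdots+n_s}\int_{[0,1)^s}f^{(n_1,\dots,n_s)}(\boldsymbol x)\prod_{j=1}^s\overline{\mathrm{wal}_{(k_j)_{>n_j}}(x_j)}\,W\big((k_j)_{\le n_j}\big)(x_j)\,d\boldsymbol x.$$ -/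

import Mathlib

open scoped ComplexConjugate

namespace Walsh

/-- The coefficient of `b ^ i` in the `b`-adic expansion of the nonnegative integer `k`. -/
def digit (b k i : ℕ) : ℕ := (Nat.digits b k).getD i 0

/-- For `k = κ₁ b ^ (a₁ - 1) + ⋯ + κᵥ b ^ (aᵥ - 1)` with `0 < κᵢ < b` and `a₁ > ⋯ > aᵥ ≥ 1`, the
list `[a₁ - 1, …, aᵥ - 1]` of the positions of the nonzero `b`-adic digits of `k`, in decreasing
order; it is empty for `k = 0`. -/
def positions (b k : ℕ) : List ℕ :=
  ((List.range (Nat.digits b k).length).filter (fun i => digit b k i ≠ 0)).reverse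

/-- The Hamming weight `v(k) = v`: the number of nonzero `b`-adic digits of `k`. -/
def weight (b k : ℕ) : ℕ := (positions b k).length

/-- The list `[κ₁ b ^ (a₁ - 1), …, κᵥ b ^ (aᵥ - 1)]` of the nonzero terms of the `b`-adic
expansion of `k`, in decreasing order. -/
def terms (b k : ℕ) : List ℕ := (positions b k).map (fun i => digit b k i * b ^ i)

/-- `k_{≤ n}`, the sum of the first `min (n, v)` terms of the expansion of `k`. -/
def leadPart (b n k : ℕ) : ℕ := ((terms b k).take n).sum

/-- `k_{> n}`, the sum of the terms with index `n + 1, …, v` of the expansion of `k`. -/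
def tailPart (b n k : ℕ) : ℕ := ((terms b k).drop n).sum

/-- `κᵥ b ^ (aᵥ - 1)`, the smallest term of the expansion of `k`; only used for `k > 0`. -/
def lastTerm (b k : ℕ) : ℕ := (terms b k).getLastD 0

theorem lastTerm_pos (b : ℕ) [NeZero b] {k : ℕ} (hk : k ≠ 0) : 0 < lastTerm b k := by
  have hne : Nat.digits b k ≠ [] := Nat.digits_ne_nil_iff_ne_zero.mpr hk
  have hlast := Nat.getLast_digit_ne_zero b hk
  have hlen : 0 < (Nat.digits b k).length := List.length_pos_iff.mpr hne
  have hmem : (Nat.digits b k).length - 1 ∈ positions b k := by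
    have hd : digit b k ((Nat.digits b k).length - 1) ≠ 0 := by
      rw [List.getLast_eq_getElem] at hlast
      rwa [digit, List.getD_eq_getElem _ _ (by omega)]
    rw [positions, List.mem_reverse, List.mem_filter]
    exact ⟨List.mem_range.mpr (by omega), by simpa using hd⟩
  have hT : terms b k ≠ [] := by
    simpa [terms] using List.ne_nil_of_mem hmem
  have hin : lastTerm b k ∈ terms b k := by
    rw [lastTerm, List.getLastD_eq_getLast?, List.getLast?_eq_some_getLast hT]
    exact List.getLast_mem hT
  obtain ⟨i, hi, hi'⟩ := List.mem_map.mp hin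
  rw [← hi']
  rw [positions, List.mem_reverse, List.mem_filter] at hi
  have h0 : digit b k i ≠ 0 := by simpa using hi.2
  exact Nat.mul_pos (Nat.pos_of_ne_zero h0) (pow_pos (Nat.pos_of_ne_zero (NeZero.ne b)) i)

/-- The `b`-adic Walsh function `wal_k (x) = ω_b ^ (∑ᵢ κᵢ ξ_{aᵢ})` with `ω_b = exp (2 π i / b)`,
where `x = ξ₁ b⁻¹ + ξ₂ b⁻² + ⋯` in `[0, 1)` has infinitely many digits different from `b - 1`.
`Real.digits x b i` is the digit `ξ_{i + 1}`. -/
noncomputable def wal (b : ℕ) [NeZero b] (k : ℕ) (x : ℝ) : ℂ :=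
  Complex.exp (2 * Real.pi * Complex.I / b) ^
    ((positions b k).map (fun i => digit b k i * (Real.digits x b i : ℕ))).sum

/-- The function `W(k)(x)`: `W(0)(x) = 1`, and for `k > 0`
`W(k)(x) = ∫₀ˣ conj (wal_{κᵥ b ^ (aᵥ - 1)} (y)) W(k')(y) dy` with `k' = k - κᵥ b ^ (aᵥ - 1)`. -/
noncomputable def W (b : ℕ) [NeZero b] (k : ℕ) (x : ℝ) : ℂ :=
  if h : k = 0 then 1
  else ∫ y in (0 : ℝ)..x, conj (wal b (lastTerm b k) y) * W b (k - lastTerm b k) y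
termination_by k
decreasing_by exact Nat.sub_lt (Nat.pos_of_ne_zero h) (lastTerm_pos b h)

/-- The closed unit cube `[0, 1]^s`. -/
def closedCube (s : ℕ) : Set (Fin s → ℝ) := Set.univ.pi fun _ => Set.Icc 0 1

/-- The half-open unit cube `[0, 1)^s`. -/
def cube (s : ℕ) : Set (Fin s → ℝ) := Set.univ.pi fun _ => Set.Ico 0 1

/-- The multivariate Walsh function `∏ⱼ wal_{kⱼ} (xⱼ)`. -/
noncomputable def walMulti (b : ℕ) [NeZero b] {s : ℕ} (k : Fin s → ℕ) (x : Fin s → ℝ) : ℂ :=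
  ∏ j, wal b (k j) (x j)

/-- The `k`-th Walsh coefficient of `f`. -/
noncomputable def coeff (b : ℕ) [NeZero b] {s : ℕ} (f : (Fin s → ℝ) → ℂ) (k : Fin s → ℕ) : ℂ :=
  ∫ x in cube s, f x * conj (walMulti b k x)

/-- The partial derivative `∂g/∂xⱼ` of a function on `[0, 1]^s` (one-sided on the faces). On the
closed cube it depends only on the values of `g` there. -/
noncomputable def partialDeriv {s : ℕ} (j : Fin s) (g : (Fin s → ℝ) → ℝ) (x : Fin s → ℝ) : ℝ :=
  derivWithin (fun t => g (Function.update x j t)) (Set.Icc 0 1) (x j)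

/-- `f^{(n₁, …, n_s)} = (∂/∂x₁)^{n₁} ⋯ (∂/∂x_s)^{n_s} f`. -/
noncomputable def mixedDeriv {s : ℕ} (n : Fin s → ℕ) (f : (Fin s → ℝ) → ℝ) :
    (Fin s → ℝ) → ℝ :=
  (List.finRange s).foldr (fun j g => (partialDeriv j)^[n j] g) f

/-- `f : [0, 1]^s → ℝ` has continuous mixed partial derivatives up to order `αⱼ` in each variable
`xⱼ`: for all `mⱼ ≤ αⱼ` the derivative `f^{(m₁, …, m_s)}` exists and is continuous on `[0, 1]^s`.
In `exists_deriv`, if `mᵢ = 0` for `i < j`, then `∂/∂xⱼ` is the next derivative to be taken in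
`(∂/∂x₁)^{⋯} ⋯ (∂/∂xⱼ)^{mⱼ + 1} (∂/∂x_{j+1})^{m_{j+1}} ⋯ (∂/∂x_s)^{m_s} f`; the condition says
that each of these successive one-variable derivatives exists. -/
structure HasContMixedDerivs {s : ℕ} (α : Fin s → ℕ) (f : (Fin s → ℝ) → ℝ) : Prop where
  exists_deriv : ∀ (m : Fin s → ℕ) (j : Fin s), (∀ i, m i ≤ α i) → (∀ i < j, m i = 0) →
    m j < α j → ∀ x ∈ closedCube s,
      DifferentiableWithinAt ℝ (fun t => mixedDeriv m f (Function.update x j t))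
        (Set.Icc 0 1) (x j)
  continuousOn : ∀ m : Fin s → ℕ, (∀ i, m i ≤ α i) →
    ContinuousOn (mixedDeriv m f) (closedCube s)

end Walsh

/-!
The identity is integration by parts, one variable at a time. The point is that
`conj (wal_{k_{> n + 1}}) W(k_{≤ n + 1})` is the primitive of `conj (wal_{k_{> n}}) W(k_{≤ n})`
which vanishes at `0`, and that it also vanishes at `1`, so that no boundary terms appear.

Let `κ b ^ p` be the `(n + 1)`-st term of `k`. The product of `conj (wal_{κ b ^ p})` and
`W(k_{≤ n})` is multiplied by a root of unity `z ≠ 1` with `z ^ b = 1` under the translation by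
`b ^ (-(p + 1))`. Its integrals over `b` consecutive translates therefore cancel, and its primitive
`W(k_{≤ n + 1})` is `b ^ (-p)`-periodic and zero at all multiples of `b ^ (-p)`. The remaining
factor `conj (wal_{k_{> n + 1}})` only involves digits of `k` below position `p`: it is constant
between consecutive multiples of `b ^ (-p)`, so multiplying by it commutes with taking the
primitive.
-/

namespace Walsh

open MeasureTheory Set

section Digits

variable {b : ℕ}

theorem digit_eq_div_mod (hb : 2 ≤ b) (k i : ℕ) : digit b k i = k / b ^ i % b :=
  Nat.getD_digits k i hb

theorem digit_mod_pow_of_lt (hb : 2 ≤ b) (k : ℕ) {i p : ℕ} (hi : i < p) :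
    digit b (k % b ^ p) i = digit b k i := by
  obtain ⟨d, rfl⟩ := Nat.exists_eq_add_of_lt hi
  rw [digit_eq_div_mod hb, digit_eq_div_mod hb, add_assoc, pow_add,
    Nat.mod_mul_right_div_self, Nat.mod_mod_of_dvd _ (dvd_pow_self b d.succ_ne_zero)]

theorem digit_mul_pow_of_lt (hb : 2 ≤ b) (m : ℕ) {i p : ℕ} (hi : i < p) :
    digit b (m * b ^ p) i = 0 := by
  obtain ⟨d, rfl⟩ := Nat.exists_eq_add_of_lt hi
  have hfactor : m * b ^ (i + d + 1) = m * b ^ d * b * b ^ i := by ring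
  rw [digit_eq_div_mod hb, hfactor, Nat.mul_div_cancel _ (pow_pos (by lia) i), Nat.mul_mod_left]

theorem digit_mul_pow_self (hb : 2 ≤ b) (m p : ℕ) : digit b (m * b ^ p) p = m % b := by
  rw [digit_eq_div_mod hb, Nat.mul_div_cancel _ (pow_pos (by lia) p)]

theorem lt_of_digit_ne_zero (hb : 2 ≤ b) {k i N : ℕ} (hk : k < b ^ N) (hi : digit b k i ≠ 0) :
    i < N := by
  by_contra! hN
  rw [digit_eq_div_mod hb,
    Nat.div_eq_of_lt (hk.trans_le (Nat.pow_le_pow_right (by lia) hN)), Nat.zero_mod] at hi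
  exact hi rfl

theorem sum_range_digit_mul_pow (hb : 2 ≤ b) (k N : ℕ) :
    ∑ i ∈ Finset.range N, digit b k i * b ^ i = k % b ^ N := by
  induction N with
  | zero => simp [Nat.mod_one]
  | succ N ih => rw [Finset.sum_range_succ, ih, Nat.mod_pow_succ, digit_eq_div_mod hb, mul_comm]

theorem mem_positions {k i : ℕ} : i ∈ positions b k ↔ digit b k i ≠ 0 := by
  simp only [positions, List.mem_reverse, List.mem_filter, List.mem_range, decide_eq_true_eq,
    and_iff_right_iff_imp]
  intro hi
  by_contra! hlen
  exact hi (List.getD_eq_default _ _ hlen)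

theorem pairwise_positions (b k : ℕ) : (positions b k).Pairwise (· > ·) := by
  rw [positions, List.pairwise_reverse]
  exact List.pairwise_lt_range.filter _

theorem sum_map_eq_sum_range {M : Type*} [AddCommMonoid M] {L : List ℕ} (hL : L.Nodup)
    {g : ℕ → M} {N : ℕ} (hlt : ∀ i ∈ L, i < N) (hg : ∀ i < N, i ∉ L → g i = 0) :
    (L.map g).sum = ∑ i ∈ Finset.range N, g i := by
  rw [← List.sum_toFinset g hL]
  refine Finset.sum_subset (fun i hi => ?_) fun i hi hiL => ?_
  · exact Finset.mem_range.mpr (hlt i (List.mem_toFinset.mp hi))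
  · exact hg i (Finset.mem_range.mp hi) fun h => hiL (List.mem_toFinset.mpr h)

theorem sum_map_positions {M : Type*} [AddCommMonoid M] (hb : 2 ≤ b) {k N : ℕ} (hk : k < b ^ N)
    {g : ℕ → M} (hg : ∀ i, digit b k i = 0 → g i = 0) :
    ((positions b k).map g).sum = ∑ i ∈ Finset.range N, g i :=
  sum_map_eq_sum_range (pairwise_positions b k).nodup
    (fun _ hi => lt_of_digit_ne_zero hb hk (mem_positions.mp hi))
    fun i _ hi => hg i (not_not.mp (mt mem_positions.mpr hi))

theorem sum_terms (hb : 2 ≤ b) (k : ℕ) : (terms b k).sum = k := by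
  have hk : k < b ^ k := Nat.lt_pow_self hb
  rw [terms, sum_map_positions hb hk fun i hi => by rw [hi, zero_mul],
    sum_range_digit_mul_pow hb, Nat.mod_eq_of_lt hk]

theorem leadPart_add_tailPart (hb : 2 ≤ b) (n k : ℕ) : leadPart b n k + tailPart b n k = k := by
  rw [leadPart, tailPart, List.sum_take_add_sum_drop, sum_terms hb]

theorem leadPart_zero (b k : ℕ) : leadPart b 0 k = 0 := rfl

theorem tailPart_zero (hb : 2 ≤ b) (k : ℕ) : tailPart b 0 k = k := sum_terms hb k

theorem mem_drop_succ_iff {α : Type*} [Preorder α] {L : List α} (hL : L.Pairwise (· > ·))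
    {n : ℕ} (hn : n < L.length) {a : α} : a ∈ L.drop (n + 1) ↔ a ∈ L ∧ a < L[n] := by
  rw [List.pairwise_iff_getElem] at hL
  constructor
  · intro ha
    obtain ⟨i, hi, rfl⟩ := List.mem_iff_getElem.mp ha
    rw [List.getElem_drop]
    exact ⟨List.getElem_mem _, hL _ _ _ _ (by lia)⟩
  · rintro ⟨ha, hlt⟩
    obtain ⟨i, hi, rfl⟩ := List.mem_iff_getElem.mp ha
    have hni : n < i := by
      by_contra! hin
      rcases hin.eq_or_lt with rfl | hin
      · exact lt_irrefl _ hlt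
      · exact lt_asymm hlt (hL i n hi hn hin)
    exact List.mem_drop_iff_getElem.mpr ⟨i - (n + 1), by lia, by congr; lia⟩

theorem tailPart_succ_eq_mod_pow (hb : 2 ≤ b) {n k : ℕ} (hn : n < (positions b k).length) :
    tailPart b (n + 1) k = k % b ^ (positions b k)[n] := by
  have hmem : ∀ i, i ∈ (positions b k).drop (n + 1) ↔ digit b k i ≠ 0 ∧ i < (positions b k)[n] :=
    fun i => by rw [mem_drop_succ_iff (pairwise_positions b k) hn, mem_positions]
  have hnodup : ((positions b k).drop (n + 1)).Nodup :=
    (pairwise_positions b k).nodup.sublist (List.drop_sublist _ _)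
  rw [tailPart, terms, ← List.map_drop, sum_map_eq_sum_range hnodup fun i hi => ((hmem i).mp hi).2,
    sum_range_digit_mul_pow hb]
  intro i hi hdrop
  rw [not_not.mp fun hne => hdrop ((hmem i).mpr ⟨hne, hi⟩), zero_mul]

theorem tailPart_eq_mod_pow_succ (hb : 2 ≤ b) {n k : ℕ} (hn : n < (positions b k).length) :
    tailPart b n k = k % b ^ ((positions b k)[n] + 1) := by
  have hdrop : tailPart b n k =
      digit b k (positions b k)[n] * b ^ (positions b k)[n] + tailPart b (n + 1) k := by
    rw [tailPart, tailPart, terms, ← List.map_drop, ← List.map_drop, List.drop_eq_getElem_cons hn,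
      List.map_cons, List.sum_cons]
  rw [hdrop, tailPart_succ_eq_mod_pow hb hn, Nat.mod_pow_succ, digit_eq_div_mod hb]
  ring

theorem leadPart_eq_of_tailPart_eq_mod (hb : 2 ≤ b) {n k q : ℕ} (h : tailPart b n k = k % q) :
    leadPart b n k = k / q * q := by
  have hadd := leadPart_add_tailPart hb n k
  have hdiv := Nat.div_add_mod' k q
  lia

theorem lastTerm_mul_pow (hb : 2 ≤ b) {m : ℕ} (hm : m % b ≠ 0) (p : ℕ) :
    lastTerm b (m * b ^ p) = m % b * b ^ p := by
  have hdigit := digit_mul_pow_self hb m p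
  have hlen : p < (Nat.digits b (m * b ^ p)).length := by
    by_contra! hlen
    exact hm (hdigit ▸ List.getD_eq_default _ _ hlen)
  have hfind : (positions b (m * b ^ p)).getLast? = some p := by
    rw [positions, List.getLast?_reverse, List.head?_filter, List.find?_range_eq_some]
    refine ⟨by simpa only [hdigit, decide_eq_true_eq] using hm, List.mem_range.mpr hlen,
      fun i hi => ?_⟩
    simp [digit_mul_pow_of_lt hb m hi]
  rw [lastTerm, List.getLastD_eq_getLast?, terms, List.getLast?_map, hfind, Option.map_some,
    Option.getD_some, hdigit]

end Digits

section Analysis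

variable {E : Type*}

theorem absolutelyContinuousOnInterval_of_dist_le {X Y : Type*} [PseudoMetricSpace X]
    [PseudoMetricSpace Y] {g : ℝ → X} {h : ℝ → Y} {a b : ℝ}
    (hh : AbsolutelyContinuousOnInterval h a b)
    (hle : ∀ x ∈ uIcc a b, ∀ y ∈ uIcc a b, dist (g x) (g y) ≤ dist (h x) (h y)) :
    AbsolutelyContinuousOnInterval g a b := by
  refine squeeze_zero' (.of_forall fun _ => Finset.sum_nonneg fun _ _ => dist_nonneg) ?_ hh
  refine Filter.eventually_inf_principal.mpr (.of_forall fun I hI => Finset.sum_le_sum ?_)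
  exact fun i hi => hle _ (hI.1 i hi).1 _ (hI.1 i hi).2

theorem absolutelyContinuousOnInterval_integral [NormedAddCommGroup E] [NormedSpace ℝ E]
    {f : ℝ → E} {a b : ℝ} (hf : IntervalIntegrable f volume a b) :
    AbsolutelyContinuousOnInterval (fun x => ∫ y in a..x, f y) a b := by
  refine absolutelyContinuousOnInterval_of_dist_le
    (hf.norm.absolutelyContinuousOnInterval_intervalIntegral left_mem_uIcc) fun x hx y hy => ?_
  have hsub : ∀ z ∈ uIcc a b, IntervalIntegrable f volume a z := fun z hz =>
    hf.mono_set (uIcc_subset_uIcc_left hz)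
  rw [dist_comm, dist_comm (∫ v in a..x, ‖f v‖), dist_eq_norm, dist_eq_norm,
    intervalIntegral.integral_interval_sub_left (hsub y hy) (hsub x hx),
    intervalIntegral.integral_interval_sub_left (hsub y hy).norm (hsub x hx).norm]
  exact intervalIntegral.norm_integral_le_abs_integral_norm

theorem integral_smul_eq_sub_integral_deriv_smul [NormedAddCommGroup E] [NormedSpace ℝ E]
    [CompleteSpace E] {u : ℝ → ℝ} {f : ℝ → E} {a b : ℝ}
    (hu : AbsolutelyContinuousOnInterval u a b) (hf : IntervalIntegrable f volume a b) :
    ∫ x in a..b, u x • f x =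
      u b • (∫ x in a..b, f x) - ∫ x in a..b, deriv u x • ∫ y in a..x, f y := by
  set F : ℝ → E := fun x => ∫ y in a..x, f y with hF
  have hF_ac : AbsolutelyContinuousOnInterval F a b := absolutelyContinuousOnInterval_integral hf
  have hsum₁ : IntervalIntegrable (fun x => u x • f x) volume a b :=
    hf.continuousOn_smul hu.continuousOn
  have hsum₂ : IntervalIntegrable (fun x => deriv u x • F x) volume a b :=
    hu.intervalIntegrable_deriv.smul_continuousOn hF_ac.continuousOn
  have hderiv : ∀ᵐ x, x ∈ uIcc a b →
      HasDerivAt (u • F - fun x => ∫ y in a..x, (u y • f y + deriv u y • F y)) 0 x := by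
    filter_upwards [hu.ae_differentiableAt, hf.ae_hasDerivAt_integral,
      (hsum₁.add hsum₂).ae_hasDerivAt_integral] with x hux hfx hsumx hx
    convert! ((hux hx).hasDerivAt.smul (hfx hx a left_mem_uIcc)).sub
      (hsumx hx a left_mem_uIcc) using 1
    exact (sub_self _).symm
  obtain ⟨C, hC⟩ := ((hu.smul hF_ac).sub (absolutelyContinuousOnInterval_integral
    (hsum₁.add hsum₂))).const_of_ae_hasDerivAt_zero hderiv
  have hconst := (hC b right_mem_uIcc).trans (hC a left_mem_uIcc).symm
  simp only [Pi.sub_apply, Pi.smul_apply', hF, intervalIntegral.integral_same, smul_zero,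
    sub_zero] at hconst
  rw [sub_eq_zero.mp hconst, intervalIntegral.integral_add hsum₁ hsum₂, add_sub_cancel_right]

theorem integral_smul_eq_neg_integral_derivWithin_smul [NormedAddCommGroup E] [NormedSpace ℝ E]
    [CompleteSpace E] {u : ℝ → ℝ} {f : ℝ → E} {a b : ℝ} (hab : a ≤ b)
    (hu : ContDiffOn ℝ 1 u (Icc a b)) (hf : IntervalIntegrable f volume a b)
    (hf₀ : ∫ x in a..b, f x = 0) :
    ∫ x in a..b, u x • f x = -∫ x in a..b, derivWithin u (Icc a b) x • ∫ y in a..x, f y := by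
  have hu_ac : AbsolutelyContinuousOnInterval u a b := by
    rw [← uIcc_of_le hab] at hu
    exact hu.absolutelyContinuousOnInterval
  rw [integral_smul_eq_sub_integral_deriv_smul hu_ac hf, hf₀, smul_zero, zero_sub]
  refine congrArg _ (intervalIntegral.integral_congr_Ioo_of_le hab fun x hx => ?_)
  rw [derivWithin_of_mem_nhds (Icc_mem_nhds hx.1 hx.2)]

theorem setIntegral_Ico_smul_eq_neg {E : Type*} [NormedAddCommGroup E] [NormedSpace ℝ E]
    [CompleteSpace E] {u : ℝ → ℝ} {f : ℝ → E} {a b : ℝ} (hab : a ≤ b)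
    (hu : ContDiffOn ℝ 1 u (Icc a b)) (hf : IntegrableOn f (Ico a b))
    (hf₀ : ∫ x in a..b, f x = 0) :
    ∫ x in Ico a b, u x • f x =
      -∫ x in Ico a b, derivWithin u (Icc a b) x • ∫ y in a..x, f y := by
  have hf' := (intervalIntegrable_iff_integrableOn_Ico_of_le hab).mpr hf
  simpa only [intervalIntegral.integral_of_le hab, integral_Ico_eq_integral_Ioo,
    integral_Ioc_eq_integral_Ioo] using
    integral_smul_eq_neg_integral_derivWithin_smul hab hu hf' hf₀

theorem map_add_natCast_mul {M : Type*} [Monoid M] [MulAction M E] {f : ℝ → E} {δ : ℝ} {z : M}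
    (hδ : 0 ≤ δ) (hf : ∀ x, 0 ≤ x → f (x + δ) = z • f x) {x : ℝ} (hx : 0 ≤ x) (n : ℕ) :
    f (x + n * δ) = z ^ n • f x := by
  induction n with
  | zero => simp
  | succ n ih =>
    rw [pow_succ', mul_smul, ← ih, ← hf _ (by positivity)]
    push_cast
    ring_nf

theorem integral_add_natCast_mul {𝕜 : Type*} [NormedField 𝕜] [NormedAddCommGroup E]
    [NormedSpace ℝ E] [NormedSpace 𝕜 E] [SMulCommClass ℝ 𝕜 E] {f : ℝ → E} {δ : ℝ} {z : 𝕜} {N : ℕ}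
    (hint : ∀ u v, IntervalIntegrable f volume u v) (hδ : 0 ≤ δ)
    (hf : ∀ x, 0 ≤ x → f (x + δ) = z • f x) (hz : z ≠ 1) (hzN : z ^ N = 1) {x : ℝ} (hx : 0 ≤ x) :
    ∫ y in (0 : ℝ)..x + N * δ, f y = ∫ y in (0 : ℝ)..x, f y := by
  set A : E := ∫ y in (0 : ℝ)..δ, f y
  have hshift : ∀ t, 0 ≤ t → ∫ y in (0 : ℝ)..t + δ, f y = A + z • ∫ y in (0 : ℝ)..t, f y := by
    intro t ht
    rw [← intervalIntegral.integral_add_adjacent_intervals (hint 0 δ) (hint δ (t + δ)),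
      ← intervalIntegral.integral_smul]
    nth_rewrite 2 [← zero_add δ]
    rw [← intervalIntegral.integral_comp_add_right]
    congr 1
    refine intervalIntegral.integral_congr fun y hy => hf y ?_
    rw [uIcc_of_le ht] at hy
    exact hy.1
  -- `(1 - z)⁻¹ • A` is the fixed point of the affine map `v ↦ A + z • v` in `hshift`.
  have hscale : ∀ t, 0 ≤ t → (∫ y in (0 : ℝ)..t + δ, f y) - (1 - z)⁻¹ • A =
      z • ((∫ y in (0 : ℝ)..t, f y) - (1 - z)⁻¹ • A) := by
    intro t ht
    have hA : A = (1 - z) • (1 - z)⁻¹ • A := (smul_inv_smul₀ (sub_ne_zero.mpr hz.symm) A).symm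
    rw [hshift t ht, smul_sub]
    nth_rewrite 1 [hA]
    module
  have hperiod := map_add_natCast_mul (f := fun t => (∫ y in (0 : ℝ)..t, f y) - (1 - z)⁻¹ • A)
    hδ hscale hx N
  rwa [hzN, one_smul, sub_left_inj] at hperiod

section FloorStep

variable {𝕜 : Type*} {f : ℝ → E} {c : ℕ → 𝕜} {r : ℝ}

theorem eqOn_floor_smul [SMul 𝕜 E] (hr : 0 < r) {m : ℕ} {x : ℝ} (hx : x ≤ (m + 1) / r) :
    EqOn (fun y => c m • f y) (fun y => c ⌊y * r⌋₊ • f y) (Ioo (m / r) x) := by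
  intro y hy
  have hfloor : ⌊y * r⌋₊ = m := by
    rw [Nat.floor_eq_iff (mul_nonneg ((by positivity : 0 ≤ m / r).trans hy.1.le) hr.le)]
    exact ⟨((div_lt_iff₀ hr).mp hy.1).le, (lt_div_iff₀ hr).mp (hy.2.trans_le hx)⟩
  simp only [hfloor]

variable [NormedField 𝕜] [NormedAddCommGroup E] [NormedSpace 𝕜 E]

theorem intervalIntegrable_floor_smul (hr : 0 < r)
    (hint : ∀ u v, IntervalIntegrable f volume u v) (m : ℕ) :
    IntervalIntegrable (fun y => c ⌊y * r⌋₊ • f y) volume 0 (m / r) := by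
  induction m with
  | zero => simp
  | succ m ih =>
    refine ih.trans (((hint _ _).smul (c m)).congr_uIoo ?_)
    rw [uIoo_of_le (by gcongr; simp), Nat.cast_succ]
    exact eqOn_floor_smul hr le_rfl

variable [NormedSpace ℝ E] [SMulCommClass ℝ 𝕜 E]

theorem integral_floor_smul_of_le (hr : 0 < r)
    (hzero : ∀ m : ℕ, ∫ y in (0 : ℝ)..m / r, f y = 0)
    (hint : ∀ u v, IntervalIntegrable f volume u v) {m : ℕ} {x : ℝ} (hmx : m / r ≤ x)
    (hxm : x ≤ (m + 1) / r) :
    ∫ y in (m / r)..x, c ⌊y * r⌋₊ • f y = c m • ∫ y in (0 : ℝ)..x, f y := by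
  rw [← intervalIntegral.integral_congr_Ioo_of_le hmx (eqOn_floor_smul hr hxm),
    intervalIntegral.integral_smul, ← intervalIntegral.integral_add_adjacent_intervals
      (hint 0 (m / r)) (hint _ x), hzero, zero_add]

theorem integral_floor_smul (hr : 0 < r) (hint : ∀ u v, IntervalIntegrable f volume u v)
    (hzero : ∀ m : ℕ, ∫ y in (0 : ℝ)..m / r, f y = 0) {x : ℝ} (hx : 0 ≤ x) :
    ∫ y in (0 : ℝ)..x, c ⌊y * r⌋₊ • f y = c ⌊x * r⌋₊ • ∫ y in (0 : ℝ)..x, f y := by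
  have hpieces := intervalIntegrable_floor_smul (c := c) hr hint
  have hgrid : ∀ m : ℕ, ∫ y in (0 : ℝ)..m / r, c ⌊y * r⌋₊ • f y = 0 := by
    intro m
    induction m with
    | zero => simp
    | succ m ih =>
      have hle : (m : ℝ) / r ≤ (m + 1 : ℕ) / r := by gcongr; simp
      rw [← intervalIntegral.integral_add_adjacent_intervals (hpieces m)
        ((hpieces m).symm.trans (hpieces (m + 1))), ih,
        integral_floor_smul_of_le hr hzero hint hle (by rw [Nat.cast_succ]), hzero, smul_zero,
        add_zero]
  have hxr : 0 ≤ x * r := by positivity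
  have hle : ⌊x * r⌋₊ / r ≤ x := (div_le_iff₀ hr).mpr (Nat.floor_le hxr)
  have hlt : x < (⌊x * r⌋₊ + 1) / r := (lt_div_iff₀ hr).mpr (Nat.lt_floor_add_one _)
  have hpiece : IntervalIntegrable (fun y => c ⌊y * r⌋₊ • f y) volume (⌊x * r⌋₊ / r) x := by
    refine ((hint _ _).smul (c ⌊x * r⌋₊)).congr_uIoo ?_
    rw [uIoo_of_le hle]
    exact eqOn_floor_smul hr hlt.le
  rw [← intervalIntegral.integral_add_adjacent_intervals (hpieces _) hpiece, hgrid,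
    integral_floor_smul_of_le hr hzero hint hle hlt.le, zero_add]

end FloorStep

end Analysis

section WalshFunctions

variable {b : ℕ}

/-- The root of unity `ω_b = exp (2 π i / b)` whose powers are the values of the Walsh functions. -/
noncomputable def omega (b : ℕ) : ℂ := Complex.exp (2 * Real.pi * Complex.I / b)

theorem norm_omega (b : ℕ) : ‖omega b‖ = 1 := by
  have harg : 2 * Real.pi * Complex.I / b = ((2 * Real.pi / b : ℝ) : ℂ) * Complex.I := by
    push_cast
    ring
  rw [omega, harg, Complex.norm_exp_ofReal_mul_I]

theorem floor_mul_pow_of_le (hb : b ≠ 0) (x : ℝ) {q p : ℕ} (hqp : q ≤ p) :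
    ⌊x * (b : ℝ) ^ q⌋₊ = ⌊x * (b : ℝ) ^ p⌋₊ / b ^ (p - q) := by
  have hbR : (b : ℝ) ≠ 0 := Nat.cast_ne_zero.mpr hb
  rw [← Nat.floor_div_natCast, Nat.cast_pow, ← Nat.sub_add_cancel hqp, pow_add,
    Nat.add_sub_cancel, mul_left_comm, mul_div_cancel_left₀ _ (pow_ne_zero _ hbR)]

variable [NeZero b]

theorem isPrimitiveRoot_omega : IsPrimitiveRoot (omega b) b :=
  Complex.isPrimitiveRoot_exp b (NeZero.ne b)

theorem val_digits (x : ℝ) (i : ℕ) : (Real.digits x b i : ℕ) = ⌊x * b ^ (i + 1)⌋₊ % b := by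
  simp [Real.digits]

theorem norm_wal (k : ℕ) (x : ℝ) : ‖wal b k x‖ = 1 := by
  rw [wal, norm_pow, ← omega, norm_omega, one_pow]

theorem measurable_wal (b : ℕ) [NeZero b] (k : ℕ) : Measurable (wal b k) := by
  have hdigits : ∀ i, Measurable fun x : ℝ => (Real.digits x b i : ℕ) := fun i => by
    simp only [val_digits]
    exact (measurable_from_nat (f := fun m => m % b)).comp
      (Nat.measurable_floor.comp (measurable_id.mul_const _))
  refine (measurable_from_nat (f := fun m => omega b ^ m)).comp ?_
  induction positions b k with
  | nil => exact measurable_const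
  | cons p L ih =>
    simp only [List.map_cons, List.sum_cons]
    exact ((hdigits p).const_mul _).add ih

theorem wal_mod_pow (hb : 2 ≤ b) (k p : ℕ) (x : ℝ) :
    wal b (k % b ^ p) x =
      omega b ^ ∑ i ∈ Finset.range p, digit b k i * (⌊x * b ^ (i + 1)⌋₊ % b) := by
  have hlt : k % b ^ p < b ^ p := Nat.mod_lt _ (pow_pos (by lia) p)
  rw [wal, ← omega, sum_map_positions hb hlt fun i hi => by rw [hi, zero_mul]]
  congr 1
  refine Finset.sum_congr rfl fun i hi => ?_
  rw [digit_mod_pow_of_lt hb k (Finset.mem_range.mp hi), val_digits]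

theorem wal_mul_pow (hb : 2 ≤ b) {c : ℕ} (hc : c < b) (p : ℕ) (x : ℝ) :
    wal b (c * b ^ p) x = (omega b ^ c) ^ ⌊x * b ^ (p + 1)⌋₊ := by
  have hlt : c * b ^ p < b ^ (p + 1) := by
    rw [pow_succ']
    exact Nat.mul_lt_mul_of_pos_right hc (pow_pos (by lia) p)
  rw [← Nat.mod_eq_of_lt hlt, wal_mod_pow hb, Finset.sum_range_succ, Finset.sum_eq_zero, zero_add,
    digit_mul_pow_self hb, Nat.mod_eq_of_lt hc, mul_comm, pow_mul,
    ← pow_eq_pow_mod _ isPrimitiveRoot_omega.pow_eq_one, pow_right_comm]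
  intro i hi
  rw [digit_mul_pow_of_lt hb c (Finset.mem_range.mp hi), zero_mul]

theorem wal_mul_pow_add (hb : 2 ≤ b) {c : ℕ} (hc : c < b) (p : ℕ) {x : ℝ} (hx : 0 ≤ x) :
    wal b (c * b ^ p) (x + 1 / b ^ (p + 1)) = omega b ^ c * wal b (c * b ^ p) x := by
  have hbp : (b : ℝ) ^ (p + 1) ≠ 0 := pow_ne_zero _ (Nat.cast_ne_zero.mpr (NeZero.ne b))
  rw [wal_mul_pow hb hc, wal_mul_pow hb hc, add_mul, one_div_mul_cancel hbp,
    Nat.floor_add_one (by positivity), pow_succ']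

theorem wal_mod_pow_succ (hb : 2 ≤ b) (k p : ℕ) (x : ℝ) :
    wal b (k % b ^ (p + 1)) x = wal b (k / b ^ p % b * b ^ p) x * wal b (k % b ^ p) x := by
  rw [wal_mod_pow hb, wal_mod_pow hb, wal_mul_pow hb (Nat.mod_lt _ (by lia)),
    Finset.sum_range_succ, pow_add, mul_comm, digit_eq_div_mod hb k p, mul_comm (_ % b), pow_mul,
    ← pow_eq_pow_mod _ isPrimitiveRoot_omega.pow_eq_one, pow_right_comm]

theorem wal_mod_pow_floor_div (hb : 2 ≤ b) (k p : ℕ) (x : ℝ) :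
    wal b (k % b ^ p) (⌊x * b ^ p⌋₊ / b ^ p) = wal b (k % b ^ p) x := by
  have hbp : (b : ℝ) ^ p ≠ 0 := pow_ne_zero _ (Nat.cast_ne_zero.mpr (NeZero.ne b))
  rw [wal_mod_pow hb, wal_mod_pow hb]
  congr 1
  refine Finset.sum_congr rfl fun i hi => ?_
  have hip : i + 1 ≤ p := Finset.mem_range.mp hi
  rw [floor_mul_pow_of_le (NeZero.ne b) _ hip, div_mul_cancel₀ _ hbp, Nat.floor_natCast,
    ← floor_mul_pow_of_le (NeZero.ne b) x hip]

end WalshFunctions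

section Primitives

variable {b : ℕ} [NeZero b]

/-- The one-variable factor `conj (wal_l) W(h)` of the integrands in the theorem. There `l` is the
tail `k_{> n}` and `h` the leading part `k_{≤ n}` of the same `k`, but they are independent here. -/
noncomputable def kernel (b : ℕ) [NeZero b] (l h : ℕ) (x : ℝ) : ℂ := conj (wal b l x) * W b h x

theorem W_zero (x : ℝ) : W b 0 x = 1 := by
  rw [W, dif_pos rfl]

theorem W_of_ne_zero {k : ℕ} (hk : k ≠ 0) (x : ℝ) :
    W b k x = ∫ y in (0 : ℝ)..x, kernel b (lastTerm b k) (k - lastTerm b k) y := by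
  rw [W, dif_neg hk]
  rfl

theorem W_apply_zero {k : ℕ} (hk : k ≠ 0) : W b k 0 = 0 := by
  rw [W_of_ne_zero hk, intervalIntegral.integral_same]

theorem intervalIntegrable_kernel {h : ℕ} (hW : Continuous (W b h)) (l : ℕ) (u v : ℝ) :
    IntervalIntegrable (kernel b l h) volume u v := by
  have hconj : AEStronglyMeasurable (fun x => conj (wal b l x)) volume :=
    (Complex.continuous_conj.measurable.comp (measurable_wal b l)).aestronglyMeasurable
  have hbound : ∀ x, ‖conj (wal b l x)‖ ≤ 1 := fun x => by rw [RCLike.norm_conj, norm_wal]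
  have hint := hW.intervalIntegrable (μ := volume) u v
  exact ⟨hint.1.bdd_mul hconj.restrict (ae_of_all _ hbound),
    hint.2.bdd_mul hconj.restrict (ae_of_all _ hbound)⟩

theorem continuous_W (b : ℕ) [NeZero b] (k : ℕ) : Continuous (W b k) := by
  induction k using Nat.strong_induction_on with
  | h k ih =>
    rcases eq_or_ne k 0 with rfl | hk
    · simpa only [funext W_zero] using continuous_const
    · have hlt : k - lastTerm b k < k := Nat.sub_lt (Nat.pos_of_ne_zero hk) (lastTerm_pos b hk)
      rw [funext (W_of_ne_zero hk)]
      exact intervalIntegral.continuous_primitive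
        (intervalIntegrable_kernel (ih _ hlt) _) 0

theorem W_mul_pow (hb : 2 ≤ b) {m : ℕ} (hm : m % b ≠ 0) (p : ℕ) (x : ℝ) :
    W b (m * b ^ p) x =
      ∫ y in (0 : ℝ)..x, kernel b (m % b * b ^ p) (m / b * b ^ (p + 1)) y := by
  have hne : m * b ^ p ≠ 0 :=
    mul_ne_zero (fun h => hm (by rw [h, Nat.zero_mod])) (pow_ne_zero p (NeZero.ne b))
  have hsub : m * b ^ p - m % b * b ^ p = m / b * b ^ (p + 1) := by
    rw [← Nat.sub_mul, Nat.sub_eq_of_eq_add (Nat.div_add_mod' m b).symm, pow_succ', mul_assoc]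
  rw [W_of_ne_zero hne, lastTerm_mul_pow hb hm, hsub]

theorem W_mul_pow_add (hb : 2 ≤ b) (m p : ℕ) {x : ℝ} (hx : 0 ≤ x) :
    W b (m * b ^ p) (x + 1 / b ^ p) = W b (m * b ^ p) x := by
  induction m using Nat.strong_induction_on generalizing p x with
  | h m ih =>
    rcases eq_or_ne m 0 with rfl | hm
    · rw [zero_mul, W_zero, W_zero]
    have hδ : (0 : ℝ) ≤ 1 / b ^ (p + 1) := by positivity
    have hstep : (1 : ℝ) / b ^ p = b * (1 / b ^ (p + 1)) := by
      rw [mul_one_div, pow_succ',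
        div_mul_cancel_left₀ (Nat.cast_ne_zero.mpr (NeZero.ne b)), one_div]
    have hfine : ∀ y, 0 ≤ y → W b (m / b * b ^ (p + 1)) (y + 1 / b ^ (p + 1)) =
        W b (m / b * b ^ (p + 1)) y := fun y hy =>
      ih (m / b) (Nat.div_lt_self (Nat.pos_of_ne_zero hm) hb) (p + 1) hy
    rw [hstep]
    by_cases hmb : m % b = 0
    · have hfactor : m * b ^ p = m / b * b ^ (p + 1) := by
        rw [pow_succ', ← mul_assoc, Nat.div_mul_cancel (Nat.dvd_of_mod_eq_zero hmb)]
      rw [hfactor, map_add_natCast_mul (f := W b (m / b * b ^ (p + 1))) (z := (1 : ℂ)) hδ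
        (fun y hy => by rw [hfine y hy, one_smul]) hx, one_pow, one_smul]
    · have hlt : m % b < b := Nat.mod_lt _ (by lia)
      have hz : conj (omega b ^ (m % b)) ≠ 1 := by
        rw [Ne, map_eq_one_iff _ (starRingEnd ℂ).injective]
        exact isPrimitiveRoot_omega.pow_ne_one_of_pos_of_lt hmb hlt
      have hzb : conj (omega b ^ (m % b)) ^ b = 1 := by
        rw [← map_pow, pow_right_comm, isPrimitiveRoot_omega.pow_eq_one, one_pow, map_one]
      rw [W_mul_pow hb hmb, W_mul_pow hb hmb]
      refine integral_add_natCast_mul (intervalIntegrable_kernel (continuous_W b _) _) hδ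
        (fun y hy => ?_) hz hzb hx
      rw [kernel, kernel, hfine y hy, wal_mul_pow_add hb hlt p hy, map_mul, smul_eq_mul, mul_assoc]

theorem W_mul_pow_natCast_div (hb : 2 ≤ b) {m : ℕ} (hm : m ≠ 0) (p j : ℕ) :
    W b (m * b ^ p) (j / b ^ p) = 0 := by
  have hperiod := map_add_natCast_mul (f := W b (m * b ^ p)) (z := (1 : ℂ))
    (by positivity : (0 : ℝ) ≤ 1 / b ^ p)
    (fun y hy => by rw [W_mul_pow_add hb m p hy, one_smul]) le_rfl j
  rwa [zero_add, mul_one_div, one_pow, one_smul,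
    W_apply_zero (mul_ne_zero hm (pow_ne_zero p (NeZero.ne b)))] at hperiod

theorem integral_kernel_mod_pow (hb : 2 ≤ b) {k p : ℕ} (hp : digit b k p ≠ 0) {x : ℝ}
    (hx : 0 ≤ x) :
    ∫ y in (0 : ℝ)..x, kernel b (k % b ^ (p + 1)) (k / b ^ (p + 1) * b ^ (p + 1)) y =
      kernel b (k % b ^ p) (k / b ^ p * b ^ p) x := by
  have hmod : k / b ^ p % b ≠ 0 := digit_eq_div_mod hb k p ▸ hp
  have hdiv : k / b ^ p ≠ 0 := fun h => hmod (by rw [h, Nat.zero_mod])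
  set f : ℝ → ℂ := kernel b (k / b ^ p % b * b ^ p) (k / b ^ (p + 1) * b ^ (p + 1))
  have hW : ∀ t, ∫ y in (0 : ℝ)..t, f y = W b (k / b ^ p * b ^ p) t := fun t => by
    rw [W_mul_pow hb hmod, Nat.div_div_eq_div_mul, ← pow_succ]
  have hfactor : kernel b (k % b ^ (p + 1)) (k / b ^ (p + 1) * b ^ (p + 1)) =
      fun y : ℝ => conj (wal b (k % b ^ p) (⌊y * b ^ p⌋₊ / b ^ p)) • f y := by
    funext y
    rw [kernel, wal_mod_pow_floor_div hb, wal_mod_pow_succ hb, map_mul, mul_comm (conj _),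
      mul_assoc]
    rfl
  rw [hfactor, integral_floor_smul (c := fun j => conj (wal b (k % b ^ p) (j / b ^ p)))
    (pow_pos (by positivity) p) (intervalIntegrable_kernel (continuous_W b _) _)
    (fun j => by rw [hW, W_mul_pow_natCast_div hb hdiv]) hx, hW, wal_mod_pow_floor_div hb, kernel,
    smul_eq_mul]

theorem integral_kernel_parts (hb : 2 ≤ b) {n k : ℕ} (hn : n < weight b k) {x : ℝ} (hx : 0 ≤ x) :
    ∫ y in (0 : ℝ)..x, kernel b (tailPart b n k) (leadPart b n k) y =
      kernel b (tailPart b (n + 1) k) (leadPart b (n + 1) k) x := by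
  have htail := tailPart_eq_mod_pow_succ hb hn
  have htail' := tailPart_succ_eq_mod_pow hb hn
  rw [leadPart_eq_of_tailPart_eq_mod hb htail, leadPart_eq_of_tailPart_eq_mod hb htail', htail,
    htail', integral_kernel_mod_pow hb (mem_positions.mp (List.getElem_mem hn)) hx]

theorem kernel_parts_one (hb : 2 ≤ b) {n k : ℕ} (hn : n < weight b k) :
    kernel b (tailPart b (n + 1) k) (leadPart b (n + 1) k) 1 = 0 := by
  have hdigit : digit b k (positions b k)[n] ≠ 0 := mem_positions.mp (List.getElem_mem hn)
  have hdiv : k / b ^ (positions b k)[n] ≠ 0 := fun h =>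
    hdigit (by rw [digit_eq_div_mod hb, h, Nat.zero_mod])
  have hW := W_mul_pow_natCast_div hb hdiv (positions b k)[n] (b ^ (positions b k)[n])
  rw [Nat.cast_pow, div_self (pow_ne_zero _ (Nat.cast_ne_zero.mpr (NeZero.ne b)))] at hW
  rw [kernel, leadPart_eq_of_tailPart_eq_mod hb (tailPart_succ_eq_mod_pow hb hn), hW, mul_zero]

end Primitives

section MixedDerivatives

theorem pi_single_induction {ι : Type*} [Finite ι] [DecidableEq ι] [Preorder ι]
    {P : (ι → ℕ) → Prop} (zero : P 0)
    (add_single : ∀ m j, (∀ i < j, m i = 0) → P m → P (m + Pi.single j 1))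
    (n : ι → ℕ) : P n := by
  induction n using WellFoundedLT.induction with
  | ind n ih =>
    rcases eq_or_ne n 0 with rfl | hn
    · exact zero
    obtain ⟨j, hj, hmin⟩ := wellFounded_lt.has_min {i | n i ≠ 0} (Function.ne_iff.mp hn)
    have hle : Pi.single j 1 ≤ n :=
      update_le_iff.mpr ⟨Nat.one_le_iff_ne_zero.mpr hj, fun _ _ => Nat.zero_le _⟩
    have hlt : n - Pi.single j 1 < n - Pi.single j 1 + Pi.single j 1 :=
      lt_add_of_pos_right _ (Pi.single_pos.mpr one_pos)
    rw [tsub_add_cancel_of_le hle] at hlt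
    rw [← tsub_add_cancel_of_le hle]
    refine add_single _ j (fun i hi => ?_) (ih _ hlt)
    have hni : n i = 0 := not_not.mp fun h => hmin i h hi
    rw [Pi.sub_apply, hni, zero_tsub]

variable {s : ℕ}

theorem mixedDeriv_zero (f : (Fin s → ℝ) → ℝ) : mixedDeriv 0 f = f := by
  rw [mixedDeriv]
  induction List.finRange s with
  | nil => rfl
  | cons _ _ ih => exact ih

theorem mixedDeriv_add_single {m : Fin s → ℕ} {j : Fin s} (hm : ∀ i < j, m i = 0)
    (f : (Fin s → ℝ) → ℝ) :
    mixedDeriv (m + Pi.single j 1) f = partialDeriv j (mixedDeriv m f) := by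
  set m' := m + Pi.single j 1
  have hself : m' j = m j + 1 := congrArg (m j + ·) (Pi.single_eq_same j 1)
  have hne : ∀ i ≠ j, m' i = m i := fun i hi =>
    (congrArg (m i + ·) (Pi.single_eq_of_ne hi 1)).trans (add_zero _)
  have hfoldr : ∀ l : List (Fin s), l.Pairwise (· < ·) → j ∈ l →
      l.foldr (fun i g => (partialDeriv i)^[m' i] g) f =
        partialDeriv j (l.foldr (fun i g => (partialDeriv i)^[m i] g) f) := by
    intro l hl hj
    induction l with
    | nil => exact absurd hj List.not_mem_nil
    | cons a l ih =>
      obtain ⟨ha, hl⟩ := List.pairwise_cons.mp hl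
      simp only [List.foldr_cons]
      rcases List.mem_cons.mp hj with rfl | hjl
      · rw [hself, Function.iterate_succ_apply']
        congr 2
        exact List.foldr_ext _ _ _ fun i hi g => by rw [hne i (ha i hi).ne']
      · rw [hne a (ha j hjl).ne, hm a (ha j hjl), ih hl hjl]
        rfl
  exact hfoldr _ (List.pairwise_lt_finRange s) (List.mem_finRange j)

theorem partialDeriv_insertNth {j : Fin (s + 1)} {g : (Fin (s + 1) → ℝ) → ℝ} (t : ℝ)
    (y : Fin s → ℝ) :
    partialDeriv j g (j.insertNth t y) =
      derivWithin (fun u => g (j.insertNth u y)) (Icc 0 1) t := by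
  simp only [partialDeriv, Fin.update_insertNth, Fin.insertNth_apply_same]

theorem insertNth_mem_univ_pi {α : Fin (s + 1) → Type*} {t : ∀ i, Set (α i)} {j : Fin (s + 1)}
    {u : α j} {y : ∀ i, α (j.succAbove i)} :
    j.insertNth u y ∈ univ.pi t ↔ u ∈ t j ∧ y ∈ univ.pi fun i => t (j.succAbove i) := by
  simp only [mem_univ_pi, Fin.forall_iff_succAbove j, Fin.insertNth_apply_same,
    Fin.insertNth_apply_succAbove]

theorem contDiffOn_insertNth {j : Fin (s + 1)} {g : (Fin (s + 1) → ℝ) → ℝ}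
    (hdiff : ∀ x ∈ closedCube (s + 1),
      DifferentiableWithinAt ℝ (fun t => g (Function.update x j t)) (Icc 0 1) (x j))
    (hcont : ContinuousOn (partialDeriv j g) (closedCube (s + 1))) {y : Fin s → ℝ}
    (hy : y ∈ closedCube s) :
    ContDiffOn ℝ 1 (fun t => g (j.insertNth t y)) (Icc 0 1) := by
  have hmem : ∀ t ∈ Icc (0 : ℝ) 1, j.insertNth t y ∈ closedCube (s + 1) := fun t ht =>
    insertNth_mem_univ_pi.mpr ⟨ht, hy⟩
  refine (contDiffOn_one_iff_derivWithin (uniqueDiffOn_Icc zero_lt_one)).mpr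
    ⟨fun t ht => ?_, ?_⟩
  · simpa only [Fin.update_insertNth, Fin.insertNth_apply_same] using hdiff _ (hmem t ht)
  · have hline : Continuous fun t : ℝ => (j.insertNth t y : Fin (s + 1) → ℝ) :=
      Continuous.finInsertNth (A := fun _ => ℝ) j continuous_id continuous_const
    exact (hcont.comp hline.continuousOn hmem).congr fun t _ => (partialDeriv_insertNth t y).symm

end MixedDerivatives

section CubeIntegrals

theorem setIntegral_univ_pi_succAbove {E : Type*} [NormedAddCommGroup E] [NormedSpace ℝ E]
    {s : ℕ} {α : Fin (s + 1) → Type*} [∀ i, MeasurableSpace (α i)] (μ : ∀ i, Measure (α i))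
    [∀ i, SigmaFinite (μ i)] (j : Fin (s + 1)) {t : ∀ i, Set (α i)} {F : (∀ i, α i) → E}
    (hF : IntegrableOn F (univ.pi t) (Measure.pi μ)) :
    ∫ x in univ.pi t, F x ∂Measure.pi μ =
      ∫ y in univ.pi fun i => t (j.succAbove i), ∫ u in t j, F (j.insertNth u y) ∂μ j
        ∂Measure.pi fun i => μ (j.succAbove i) := by
  have hmp := (measurePreserving_piFinSuccAbove μ j).symm
  set e := (MeasurableEquiv.piFinSuccAbove α j).symm
  have hpre : e ⁻¹' univ.pi t = t j ×ˢ univ.pi fun i => t (j.succAbove i) := by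
    ext z
    exact insertNth_mem_univ_pi
  have hint := (hmp.integrableOn_comp_preimage e.measurableEmbedding).mpr hF
  rw [hpre, IntegrableOn, ← Measure.prod_restrict] at hint
  rw [← hmp.setIntegral_preimage_emb e.measurableEmbedding, hpre, ← Measure.prod_restrict]
  exact integral_prod_symm _ hint

variable {𝕜 : Type*} [RCLike 𝕜] {s : ℕ}

theorem integrableOn_smul_prod {g : (Fin s → ℝ) → ℝ} (hg : ContinuousOn g (closedCube s))
    {φ : Fin s → ℝ → 𝕜} (hφ : ∀ i, IntegrableOn (φ i) (Ico 0 1)) :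
    IntegrableOn (fun x => g x • ∏ i, φ i (x i)) (cube s) := by
  have hprod : IntegrableOn (fun x : Fin s → ℝ => ∏ i, φ i (x i)) (cube s) := by
    rw [IntegrableOn, cube, volume_pi, Measure.restrict_pi_pi]
    exact Integrable.fintype_prod hφ
  exact hprod.continuousOn_smul_of_subset hg (isCompact_univ_pi fun _ => isCompact_Icc)
    (MeasurableSet.univ_pi fun _ => measurableSet_Ico) (pi_mono fun _ _ => Ico_subset_Icc_self)

theorem setIntegral_cube_smul_prod_eq_neg {j : Fin (s + 1)} {g : (Fin (s + 1) → ℝ) → ℝ}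
    {φ : Fin (s + 1) → ℝ → 𝕜} (hg : ContinuousOn g (closedCube (s + 1)))
    (hdiff : ∀ x ∈ closedCube (s + 1),
      DifferentiableWithinAt ℝ (fun t => g (Function.update x j t)) (Icc 0 1) (x j))
    (hcont : ContinuousOn (partialDeriv j g) (closedCube (s + 1)))
    (hφ : ∀ i, IntegrableOn (φ i) (Ico 0 1)) (hφ₀ : ∫ t in (0 : ℝ)..1, φ j t = 0) :
    ∫ x in cube (s + 1), g x • ∏ i, φ i (x i) =
      -∫ x in cube (s + 1), partialDeriv j g x •
        ∏ i, Function.update φ j (fun t => ∫ y in (0 : ℝ)..t, φ j y) i (x i) := by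
  set ψ := Function.update φ j fun t => ∫ y in (0 : ℝ)..t, φ j y
  have hψ_self : ψ j = fun t => ∫ y in (0 : ℝ)..t, φ j y := Function.update_self ..
  have hψ_ne : ∀ i, ψ (j.succAbove i) = φ (j.succAbove i) := fun i =>
    Function.update_of_ne (Fin.succAbove_ne j i) _ _
  have hψ : ∀ i, IntegrableOn (ψ i) (Ico 0 1) := by
    refine (Fin.forall_iff_succAbove j).mpr ⟨?_, fun i => hψ_ne i ▸ hφ _⟩
    rw [hψ_self]
    have hprim := intervalIntegral.continuousOn_primitive_interval (a := 0) (b := 1)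
      (μ := volume) (f := φ j)
      (by rw [uIcc_of_le zero_le_one, integrableOn_Icc_iff_integrableOn_Ico]; exact hφ j)
    rw [uIcc_of_le zero_le_one] at hprim
    exact hprim.integrableOn_Icc.mono_set Ico_subset_Icc_self
  have hfubini : ∀ F : (Fin (s + 1) → ℝ) → 𝕜, IntegrableOn F (cube (s + 1)) →
      ∫ x in cube (s + 1), F x = ∫ y in cube s, ∫ t in Ico 0 1, F (j.insertNth t y) :=
    fun _ hF => setIntegral_univ_pi_succAbove (fun _ => volume) j hF
  rw [hfubini _ (integrableOn_smul_prod hg hφ), hfubini _ (integrableOn_smul_prod hcont hψ),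
    ← integral_neg]
  refine setIntegral_congr_fun (MeasurableSet.univ_pi fun _ => measurableSet_Ico) fun y hy => ?_
  have hu := contDiffOn_insertNth hdiff hcont (pi_mono (fun _ _ => Ico_subset_Icc_self) hy)
  simp only [Fin.prod_univ_succAbove _ j, Fin.insertNth_apply_same, Fin.insertNth_apply_succAbove,
    hψ_ne, hψ_self, partialDeriv_insertNth, ← smul_mul_assoc, integral_mul_const]
  rw [setIntegral_Ico_smul_eq_neg zero_le_one hu (hφ j) hφ₀, neg_mul]

end CubeIntegrals

section WalshCoefficients

variable {b : ℕ} [NeZero b] {s : ℕ}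

/-- The product `∏ᵢ conj (wal_{(kᵢ)_{> nᵢ}}) W((kᵢ)_{≤ nᵢ})` of one-variable kernels which is
integrated against `f^{(n₁, …, n_s)}` in the theorem. -/
noncomputable def kernelProd (b : ℕ) [NeZero b] (k n : Fin s → ℕ) (x : Fin s → ℝ) : ℂ :=
  ∏ i, kernel b (tailPart b (n i) (k i)) (leadPart b (n i) (k i)) (x i)

theorem kernelProd_zero (hb : 2 ≤ b) (k : Fin s → ℕ) (x : Fin s → ℝ) :
    kernelProd b k 0 x = conj (walMulti b k x) := by
  simp only [kernelProd, kernel, walMulti, Pi.zero_apply, tailPart_zero hb, leadPart_zero, W_zero,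
    mul_one, map_prod]

theorem prod_update_integral_kernel (hb : 2 ≤ b) {k n : Fin s → ℕ} {j : Fin s}
    (hnj : n j < weight b (k j)) {x : Fin s → ℝ} (hx : x ∈ cube s) :
    ∏ i, Function.update (fun i => kernel b (tailPart b (n i) (k i)) (leadPart b (n i) (k i))) j
        (fun t => ∫ y in (0 : ℝ)..t, kernel b (tailPart b (n j) (k j)) (leadPart b (n j) (k j)) y)
        i (x i) =
      kernelProd b k (n + Pi.single j 1) x := by
  refine Finset.prod_congr rfl fun i _ => ?_
  rcases eq_or_ne i j with rfl | hij
  · rw [Function.update_self, integral_kernel_parts hb hnj (hx i (mem_univ i)).1, Pi.add_apply,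
      Pi.single_eq_same]
  · rw [Function.update_of_ne hij, Pi.add_apply, Pi.single_eq_of_ne hij, add_zero]

theorem setIntegral_mixedDeriv_smul_kernelProd (hb : 2 ≤ b) {k α n : Fin s → ℕ}
    {f : (Fin s → ℝ) → ℝ} (hf : HasContMixedDerivs α f) {j : Fin s} (hn : ∀ i < j, n i = 0)
    (hnα : n + Pi.single j 1 ≤ α) (hnj : n j < weight b (k j)) :
    ∫ x in cube s, mixedDeriv n f x • kernelProd b k n x =
      -∫ x in cube s,
        mixedDeriv (n + Pi.single j 1) f x • kernelProd b k (n + Pi.single j 1) x := by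
  obtain _ | s := s
  · exact j.elim0
  have hnα' : n ≤ α := le_self_add.trans hnα
  have hjα : n j < α j := Nat.lt_of_succ_le (by simpa using hnα j)
  refine (setIntegral_cube_smul_prod_eq_neg (j := j) (hf.continuousOn n hnα')
    (hf.exists_deriv n j hnα' hn hjα) (mixedDeriv_add_single hn f ▸ hf.continuousOn _ hnα)
    (fun i => (intervalIntegrable_iff_integrableOn_Ico_of_le zero_le_one).mp
      (intervalIntegrable_kernel (continuous_W b _) _ 0 1))
    (by rw [integral_kernel_parts hb hnj zero_le_one, kernel_parts_one hb hnj])).trans ?_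
  rw [mixedDeriv_add_single hn]
  exact congrArg _ (setIntegral_congr_fun (MeasurableSet.univ_pi fun _ => measurableSet_Ico)
    fun x hx => congrArg _ (prod_update_integral_kernel hb hnj hx))

end WalshCoefficients

end Walsh

theorem mainTheorem9 (b : ℕ) [NeZero b] (hb : 2 ≤ b) (s : ℕ) (k α n : Fin s → ℕ)
    (f : (Fin s → ℝ) → ℝ) (hf : Walsh.HasContMixedDerivs α f)
    (hn : ∀ j, n j ≤ min (α j) (Walsh.weight b (k j))) :
    Walsh.coeff b (fun x => (f x : ℂ)) k =
      (-1) ^ (∑ j, n j) *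
        ∫ x in Walsh.cube s, (Walsh.mixedDeriv n f x : ℂ) *
          ∏ j, (conj (Walsh.wal b (Walsh.tailPart b (n j) (k j)) (x j)) *
            Walsh.W b (Walsh.leadPart b (n j) (k j)) (x j)) := by
  simp only [← Complex.real_smul]
  change _ = _ * ∫ x in Walsh.cube s, Walsh.mixedDeriv n f x • Walsh.kernelProd b k n x
  induction n using Walsh.pi_single_induction with
  | zero =>
    simp only [Walsh.coeff, Walsh.kernelProd_zero hb, Walsh.mixedDeriv_zero, Pi.zero_apply,
      Finset.sum_const_zero, pow_zero, one_mul, Complex.real_smul]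
  | add_single m j hm ih =>
    have hmα : m + Pi.single j 1 ≤ α := fun i => (hn i).trans (min_le_left _ _)
    have hmj : m j < Walsh.weight b (k j) :=
      Nat.lt_of_succ_le (by simpa using (hn j).trans (min_le_right _ _))
    have hsum : ∑ i, (m + Pi.single j 1 : Fin s → ℕ) i = ∑ i, m i + 1 := by
      simp [Finset.sum_add_distrib]
    rw [ih fun i => le_self_add.trans (hn i),
      Walsh.setIntegral_mixedDeriv_smul_kernelProd hb hf hm hmα hmj, hsum, pow_succ, mul_neg_one,
      neg_mul, mul_neg]
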